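/- Let $\mathbb K=\mathbb R$ or $\mathbb C$, and let $E$ be an $F$-space over $\mathbb K$, that is, a complete metrizable topological vector space (not necessarily locally convex). A topological vector space is called minimal if it carries no strictly weaker Hausdorff vector topology. Let $W$ be a linear subspace of $E$, not necessarily closed, that contains a closed subspace $F$ of $E$ which is non-minimal in the topology inherited from $E$. Then the following two conditions are equivalent. 1. $E\setminus W$ is spaceable, i.e. $(E\setminus W)\cup\{0\}$ contains a closed infinite-dimensional linear subspace of $E$. 2. There exist a closed linear subspace $\mathcal S$ of $\ell_\infty$ (the space of bounded $\mathbb K$-valued sequences with the supremum norm) that contains the space $c_0$ of null sequences, and a sequence $(x_n)_{n=1}^\infty$ in $E$, such that - $(x_n)$ is $\mathcal S$-independent: if $(c_n)\in\mathcal S$ and $\sum_{n=1}^\infty c_nx_n=0$, then $c_n=0$ for all $n$; and - $E\setminus W$ is $[(x_n),\mathcal S]$-lineable: for every $(c_n)\in\mathcal S$ the series $\sum_{n=1}^\infty c_nx_n$ converges in $E$ to a vector of $(E\setminus W)\cup\{0\}$. Convergence of a series means convergence of its sequence of partial sums. -/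

import Mathlib

open Filter Topology
open scoped ENNReal

/-- `t` is a Hausdorff vector topology on the `𝕜`-vector space `X`. -/
structure IsHausdorffVectorTopology (𝕜 X : Type*) [RCLike 𝕜] [AddCommGroup X] [Module 𝕜 X]
    (t : TopologicalSpace X) : Prop where
  isTopologicalAddGroup : @IsTopologicalAddGroup X t _
  continuousSMul : @ContinuousSMul 𝕜 X _ _ t
  t2Space : @T2Space X t

/-- A topological vector space `X` is minimal if there is no strictly weaker Hausdorff vector
topology on it. (In Mathlib's order on topologies, `t ≤ t'` says that `t'` is weaker than `t`.) -/
def IsMinimalTVS (𝕜 X : Type*) [RCLike 𝕜] [AddCommGroup X] [Module 𝕜 X]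
    [t : TopologicalSpace X] : Prop :=
  ∀ t' : TopologicalSpace X, IsHausdorffVectorTopology 𝕜 X t' → t ≤ t' → t' = t

/-- The series `∑ u n` converges to `x`: its sequence of partial sums does (not necessarily
unconditionally). -/
def SeriesConvergesTo {E : Type*} [AddCommGroup E] [TopologicalSpace E] (u : ℕ → E) (x : E) :
    Prop :=
  Tendsto (fun N : ℕ => ∑ n ∈ Finset.range N, u n) atTop (𝓝 x)

/-- `A` is spaceable: `A ∪ {0}` contains a closed infinite-dimensional subspace. -/
def IsSpaceable (𝕜 : Type*) {E : Type*} [RCLike 𝕜] [AddCommGroup E] [Module 𝕜 E]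
    [TopologicalSpace E] (A : Set E) : Prop :=
  ∃ F : Submodule 𝕜 E, IsClosed (F : Set E) ∧ ¬ FiniteDimensional 𝕜 F ∧ (F : Set E) ⊆ A ∪ {0}

/-- `A` is `[(u n), S]`-lineable: for every `c ∈ S`, the series `∑ c n • u n` converges to a
vector of `A ∪ {0}`. -/
def IsSeqLineable {𝕜 E : Type*} [RCLike 𝕜] [AddCommGroup E] [Module 𝕜 E] [TopologicalSpace E]
    (u : ℕ → E) (S : Submodule 𝕜 (ℕ → 𝕜)) (A : Set E) : Prop :=
  ∀ c ∈ S, ∃ x ∈ A ∪ {0}, SeriesConvergesTo (fun n => c n • u n) x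

/-- `u` is `S`-independent: the only `c ∈ S` with `∑ c n • u n = 0` is `c = 0`. -/
def IsSeqIndependent {𝕜 E : Type*} [RCLike 𝕜] [AddCommGroup E] [Module 𝕜 E] [TopologicalSpace E]
    (S : Submodule 𝕜 (ℕ → 𝕜)) (u : ℕ → E) : Prop :=
  ∀ c ∈ S, SeriesConvergesTo (fun n => c n • u n) 0 → c = 0

/-- The inclusion of `ℓ_∞` into the space of all scalar sequences. -/
def lInftyToSeq (𝕜 : Type*) [RCLike 𝕜] : lp (fun _ : ℕ => 𝕜) ∞ →ₗ[𝕜] (ℕ → 𝕜) where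
  toFun c := fun n => c n
  map_add' _ _ := rfl
  map_smul' _ _ := rfl

/-- The space `c_0` of null sequences. -/
def nullSequences (𝕜 : Type*) [RCLike 𝕜] : Submodule 𝕜 (ℕ → 𝕜) where
  carrier := {c | Tendsto c atTop (𝓝 0)}
  zero_mem' := tendsto_const_nhds
  add_mem' {a b} ha hb := by
    have h : Tendsto (fun n => a n + b n) atTop (𝓝 (0 + 0)) := Tendsto.add ha hb
    rwa [add_zero] at h
  smul_mem' r a ha := by
    have h : Tendsto (fun n => r • a n) atTop (𝓝 (r • (0 : 𝕜))) := Tendsto.const_smul ha r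
    rwa [smul_zero] at h

/-!
The topology of an F-space is described by an F-seminorm `p` (`IsFSeminorm.exists_hasBasis`).

*Spaceable implies lineable.* A linearly independent sequence in the given closed
infinite-dimensional subspace can be rescaled so that every term is tiny in comparison with all
earlier partial sums whose coefficients are bounded and not all small; such partial sums are bounded
away from zero by compactness (`exists_rescaling`). Then `∑ c n • x n` converges for all bounded
`c`, and it can only vanish for `c = 0`, so one can take all of `ℓ_∞` for the space of coefficients
(`exists_bounded_independent_sequence`).

*Lineable implies spaceable.* The subspace `F ≤ W` carries a strictly weaker Hausdorff vector
topology. The regularization `p'` of `p` that is lower semicontinuous for the weak topology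
(`lscRegularization`) is not continuous at zero for it: otherwise successive approximation, as in
the open mapping theorem, would show that the topologies agree
(`le_nhds_of_tendsto_lscRegularization`). Hence there are vectors arbitrarily small in the weak
topology with `p'` bounded below. Choosing such vectors `z n` one after another, lower
semicontinuity makes truncation of linear combinations almost decrease `p'`
(`exists_basic_sequence`, following Kalton's construction of basic sequences). The coefficients of a
linear combination of the `z n` are therefore equicontinuous, and determine limits of such
combinations (`exists_total_equicontinuous_sequence`).

Now perturb: the closed span of `z n + ε n • x n`, for small `ε n ≠ 0`, is the required subspace.
Let a sequence of combinations of these vectors converge to an element of `W`. If its coefficients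
stay bounded, then a subsequence of them converges pointwise to some bounded `b`, so that the limit
is `f + ∑ (b n * ε n) • x n` with `f ∈ F ≤ W`. Hence the series lies in `W`; as `b n * ε n` is a
null sequence, this forces `b = 0` and then `f = 0`. If they are unbounded, the same argument for
the normalized combinations contradicts equicontinuity (`eq_zero_of_mem_closure_perturbed_span`).
-/

/-! ### F-seminorms -/

/-- An F-seminorm: a subadditive function whose balls are balanced. Continuity of scalar
multiplication with respect to `p` is not part of the definition; that `p` induces a given topology
is expressed by saying that its balls are a basis of neighbourhoods of zero. -/
structure IsFSeminorm (𝕜 : Type*) {X : Type*} [RCLike 𝕜] [AddCommGroup X] [Module 𝕜 X]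
    (p : X → ℝ) : Prop where
  nonneg : ∀ x, 0 ≤ p x
  zero : p 0 = 0
  add_le : ∀ x y, p (x + y) ≤ p x + p y
  smul_le : ∀ (t : 𝕜) x, ‖t‖ ≤ 1 → p (t • x) ≤ p x

namespace IsFSeminorm

section Algebraic

variable {𝕜 X : Type*} [RCLike 𝕜] [AddCommGroup X] [Module 𝕜 X] {p : X → ℝ}

lemma neg (hp : IsFSeminorm 𝕜 p) (x : X) : p (-x) = p x := by
  have h (y : X) : p (-y) ≤ p y := by simpa using hp.smul_le (-1) y (by simp)
  exact le_antisymm (h x) (by simpa using h (-x))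

lemma sub_rev (hp : IsFSeminorm 𝕜 p) (x y : X) : p (x - y) = p (y - x) := by
  rw [← hp.neg, neg_sub]

lemma sub_le_add (hp : IsFSeminorm 𝕜 p) (x y z : X) : p (x - z) ≤ p (x - y) + p (y - z) := by
  simpa using hp.add_le (x - y) (y - z)

lemma le_sub_add (hp : IsFSeminorm 𝕜 p) (x y : X) : p x ≤ p (x - y) + p y := by
  simpa using hp.add_le (x - y) y

/-- The tail of a series with geometrically decaying terms is at most a geometric sum. -/
lemma sum_sub_sum_le (hp : IsFSeminorm 𝕜 p) {u : ℕ → X} {C : ℝ} {n₀ n N : ℕ}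
    (hu : ∀ i ≥ n₀, p (u i) ≤ C * (1 / 2) ^ i) (hn : n₀ ≤ n) (hN : n ≤ N) :
    p (∑ i ∈ Finset.range N, u i - ∑ i ∈ Finset.range n, u i)
      ≤ 2 * C * ((1 / 2) ^ n - (1 / 2) ^ N) := by
  induction N, hN using Nat.le_induction with
  | base => simp [hp.zero]
  | succ N hN ih =>
    rw [Finset.sum_range_succ, add_sub_right_comm]
    refine (hp.add_le _ _).trans ((add_le_add ih (hu N (hn.trans hN))).trans_eq ?_)
    ring

lemma sum_sub_sum_le' (hp : IsFSeminorm 𝕜 p) {u : ℕ → X} {C : ℝ} (hC : 0 ≤ C) {n₀ n N : ℕ}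
    (hu : ∀ i ≥ n₀, p (u i) ≤ C * (1 / 2) ^ i) (hn : n₀ ≤ n) (hN : n ≤ N) :
    p (∑ i ∈ Finset.range N, u i - ∑ i ∈ Finset.range n, u i) ≤ 2 * C * (1 / 2) ^ n := by
  refine (hp.sum_sub_sum_le hu hn hN).trans ?_
  gcongr
  have : (0 : ℝ) ≤ (1 / 2) ^ N := by positivity
  linarith

/-- A bounded set of linear combinations of finitely many vectors is totally bounded for an
F-seminorm that is continuous on lines. -/
lemma exists_finite_net (hp : IsFSeminorm 𝕜 p)
    (hc : ∀ x, Tendsto (fun t : 𝕜 => p (t • x)) (𝓝 0) (𝓝 0)) (x : ℕ → X) (R : ℝ) (n : ℕ) :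
    ∀ ε > 0, ∃ s : Set X, s.Finite ∧ ∀ a : ℕ → 𝕜, (∀ i < n, ‖a i‖ ≤ R) →
      ∃ y ∈ s, p (∑ i ∈ Finset.range n, a i • x i - y) < ε := by
  induction n with
  | zero => exact fun ε hε => ⟨{0}, Set.finite_singleton 0, fun a _ => ⟨0, rfl, by simpa [hp.zero]⟩⟩
  | succ n ih =>
    intro ε hε
    obtain ⟨s, hs, hsa⟩ := ih (ε / 2) (half_pos hε)
    obtain ⟨δ, hδ, hδx⟩ := Metric.eventually_nhds_iff.1
      ((hc (x n)).eventually (gt_mem_nhds (half_pos hε)))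
    obtain ⟨T, -, hT, hTc⟩ := (isCompact_closedBall (0 : 𝕜) R).finite_cover_balls hδ
    refine ⟨Set.image2 (fun y t => y + t • x n) s T, hs.image2 _ hT, fun a ha => ?_⟩
    obtain ⟨y, hy, hya⟩ := hsa a fun i hi => ha i (by omega)
    obtain ⟨t, ht, hta⟩ : ∃ t ∈ T, dist (a n) t < δ := by
      simpa using hTc (show a n ∈ Metric.closedBall 0 R by simpa using ha n (by omega))
    refine ⟨_, Set.mem_image2_of_mem hy ht, ?_⟩
    have h := hp.add_le (∑ i ∈ Finset.range n, a i • x i - y) ((a n - t) • x n)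
    have h2 : p ((a n - t) • x n) < ε / 2 := hδx (by simpa [dist_eq_norm] using hta)
    rw [Finset.sum_range_succ, show ∑ i ∈ Finset.range n, a i • x i + a n • x n - (y + t • x n)
      = (∑ i ∈ Finset.range n, a i • x i - y) + (a n - t) • x n by rw [sub_smul]; abel]
    linarith

end Algebraic

section Topological

variable {𝕜 X : Type*} [RCLike 𝕜] [AddCommGroup X] [Module 𝕜 X] {p : X → ℝ}

lemma tendsto_iff [TopologicalSpace X] [IsTopologicalAddGroup X] (hp : IsFSeminorm 𝕜 p)
    (hb : (𝓝 (0 : X)).HasBasis (fun ε : ℝ => 0 < ε) fun ε => {x | p x < ε})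
    {ι : Type*} {l : Filter ι} {s : ι → X} {x : X} :
    Tendsto s l (𝓝 x) ↔ Tendsto (fun i => p (s i - x)) l (𝓝 0) := by
  rw [← tendsto_sub_nhds_zero_iff, hb.tendsto_right_iff, Metric.tendsto_nhds]
  simp [abs_of_nonneg (hp.nonneg _)]

lemma tendsto_zero [TopologicalSpace X]
    (hp : IsFSeminorm 𝕜 p)
    (hb : (𝓝 (0 : X)).HasBasis (fun ε : ℝ => 0 < ε) fun ε => {x | p x < ε}) :
    Tendsto p (𝓝 0) (𝓝 0) := by
  rw [Metric.tendsto_nhds]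
  intro ε hε
  filter_upwards [hb.mem_of_mem hε] with x hx
  simpa [abs_of_nonneg (hp.nonneg _)] using hx

lemma tendsto_smul [TopologicalSpace X] [ContinuousSMul 𝕜 X]
    (hp : Tendsto p (𝓝 0) (𝓝 0)) (x : X) : Tendsto (fun t : 𝕜 => p (t • x)) (𝓝 0) (𝓝 0) := by
  refine hp.comp ?_
  have : Tendsto (fun t : 𝕜 => t • x) (𝓝 0) (𝓝 ((0 : 𝕜) • x)) :=
    (continuous_id.smul continuous_const).tendsto _
  rwa [zero_smul] at this

lemma cauchySeq [UniformSpace X] [IsUniformAddGroup X]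
    (hp : IsFSeminorm 𝕜 p)
    (hb : (𝓝 (0 : X)).HasBasis (fun ε : ℝ => 0 < ε) fun ε => {x | p x < ε}) {s : ℕ → X}
    (h : ∀ ε > 0, ∃ N, ∀ n ≥ N, p (s n - s N) < ε) : CauchySeq s := by
  have hu : (uniformity X).HasBasis (fun ε : ℝ => 0 < ε) fun ε => {q | p (q.2 - q.1) < ε} := by
    rw [uniformity_eq_comap_nhds_zero]
    exact hb.comap _
  refine hu.cauchySeq_iff'.2 fun ε hε => ?_
  obtain ⟨N, hN⟩ := h ε hε
  exact ⟨N, fun n hn => by simpa [hp.sub_rev (s N)] using hN n hn⟩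

lemma exists_tendsto_sum [UniformSpace X] [IsUniformAddGroup X] [CompleteSpace X]
    (hp : IsFSeminorm 𝕜 p)
    (hb : (𝓝 (0 : X)).HasBasis (fun ε : ℝ => 0 < ε) fun ε => {x | p x < ε}) {u : ℕ → X} {C : ℝ}
    {n₀ : ℕ} (hC : 0 ≤ C) (hu : ∀ i ≥ n₀, p (u i) ≤ C * (1 / 2) ^ i) :
    ∃ s, Tendsto (fun n => ∑ i ∈ Finset.range n, u i) atTop (𝓝 s) := by
  refine cauchySeq_tendsto_of_complete (hp.cauchySeq hb fun ε hε => ?_)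
  have ht : Tendsto (fun n : ℕ => 2 * C * (1 / 2 : ℝ) ^ n) atTop (𝓝 0) := by
    simpa using (tendsto_pow_atTop_nhds_zero_of_lt_one (r := (1 / 2 : ℝ)) (by norm_num)
      (by norm_num)).const_mul (2 * C)
  obtain ⟨N, hN, hN₀⟩ := ((ht.eventually (gt_mem_nhds hε)).and (eventually_ge_atTop n₀)).exists
  exact ⟨N, fun n hn => (hp.sum_sub_sum_le' hC hu hN₀ hn).trans_lt hN⟩

/-- The closed balls of an F-seminorm that induces the topology are closed. -/
lemma limit_le [TopologicalSpace X] [IsTopologicalAddGroup X]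
    (hp : IsFSeminorm 𝕜 p)
    (hb : (𝓝 (0 : X)).HasBasis (fun ε : ℝ => 0 < ε) fun ε => {x | p x < ε})
    {s : ℕ → X} {x y : X} {C : ℝ} (hs : Tendsto s atTop (𝓝 x))
    (h : ∀ᶠ n in atTop, p (s n - y) ≤ C) : p (x - y) ≤ C := by
  have h1 := ((hp.tendsto_iff hb).1 hs).add_const C
  rw [zero_add] at h1
  refine ge_of_tendsto h1 ?_
  filter_upwards [h] with n hn
  have := hp.sub_le_add x (s n) y
  rw [hp.sub_rev x (s n)] at this
  linarith

lemma continuous [TopologicalSpace X] [IsTopologicalAddGroup X]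
    (hp : IsFSeminorm 𝕜 p)
    (hb : (𝓝 (0 : X)).HasBasis (fun ε : ℝ => 0 < ε) fun ε => {x | p x < ε}) : Continuous p := by
  refine continuous_iff_continuousAt.2 fun x => Metric.tendsto_nhds.2 fun ε hε => ?_
  have h := (hp.tendsto_iff hb).1 (tendsto_id (x := 𝓝 x))
  filter_upwards [h.eventually (gt_mem_nhds hε)] with y hy
  have h1 := hp.le_sub_add x y
  have h2 := hp.le_sub_add y x
  rw [hp.sub_rev x y] at h1
  simp only [id] at hy
  rw [Real.dist_eq, abs_lt]
  constructor <;> linarith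

lemma eventually_smul_le [TopologicalSpace X] [ContinuousSMul 𝕜 X]
    (hp : Tendsto p (𝓝 0) (𝓝 0)) (y : X) (K : ℝ) {C : ℝ} (hC : 0 < C) :
    ∀ᶠ ε : 𝕜 in 𝓝 0, ∀ t : 𝕜, ‖t‖ ≤ K → p (t • ε • y) ≤ C := by
  obtain ⟨δ, hδ, h⟩ := Metric.eventually_nhds_iff.1
    ((tendsto_smul (𝕜 := 𝕜) hp y).eventually (gt_mem_nhds hC))
  filter_upwards [Metric.ball_mem_nhds (0 : 𝕜) (show 0 < δ / (|K| + 1) by positivity)] with ε hε t ht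
  rw [mem_ball_zero_iff, lt_div_iff₀ (by positivity)] at hε
  rw [smul_smul]
  refine (h ?_).le
  rw [dist_zero_right, norm_mul]
  have := le_abs_self K
  nlinarith [norm_nonneg ε, norm_nonneg t]

end Topological

/-- The topology of a metrizable topological vector space is given by an F-seminorm: for a
compatible metric `d`, take the supremum of `min 1 (d (t x + y) y)` over all `y` and all scalars
`t` in the unit ball. -/
lemma exists_hasBasis (𝕜 X : Type*) [RCLike 𝕜] [AddCommGroup X] [Module 𝕜 X] [UniformSpace X]
    [IsUniformAddGroup X] [ContinuousSMul 𝕜 X] [TopologicalSpace.MetrizableSpace X] :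
    ∃ p : X → ℝ, IsFSeminorm 𝕜 p ∧
      (𝓝 (0 : X)).HasBasis (fun ε : ℝ => 0 < ε) fun ε => {x | p x < ε} := by
  have : (uniformity X).IsCountablyGenerated := by
    rw [uniformity_eq_comap_nhds_zero]; infer_instance
  obtain ⟨I, hI⟩ := UniformSpace.metrizable_uniformity X
  let d : X → X → ℝ := fun x y => @dist X I.toDist x y
  have hd0 (x : X) : d x x = 0 := @dist_self X I x
  have hdn (x y : X) : 0 ≤ d x y := @dist_nonneg X I x y
  have hdt (x y z : X) : d x z ≤ d x y + d y z := @dist_triangle X I x y z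
  have hdu : ∀ ε > 0, {q : X × X | d q.1 q.2 < ε} ∈ uniformity X := by
    intro ε hε
    rw [← hI]
    exact @Metric.dist_mem_uniformity X I ε hε
  have hdb : ∀ U ∈ uniformity X, ∃ ε > 0, ∀ a b, d a b < ε → (a, b) ∈ U := by
    intro U hU
    rw [← hI] at hU
    obtain ⟨ε, hε, h⟩ := (@Metric.mem_uniformity_dist X I U).1 hU
    exact ⟨ε, hε, fun a b hab => h hab⟩
  clear_value d
  let g : X → X × Metric.closedBall (0 : 𝕜) 1 → ℝ :=
    fun x q => min 1 (d ((q.2 : 𝕜) • x + q.1) q.1)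
  have hg1 (x : X) : BddAbove (Set.range (g x)) := ⟨1, by rintro _ ⟨q, rfl⟩; exact min_le_left _ _⟩
  have hg0 (x : X) q : 0 ≤ g x q := le_min zero_le_one (hdn _ _)
  have hgp (x : X) q : g x q ≤ ⨆ q, g x q := le_ciSup (hg1 x) q
  have : Nonempty (X × Metric.closedBall (0 : 𝕜) 1) := ⟨(0, ⟨0, by simp⟩)⟩
  refine ⟨fun x => ⨆ q, g x q, ⟨fun x => Real.iSup_nonneg (hg0 x), ?_, ?_, ?_⟩, ?_⟩
  · simp [g, hd0]
  · intro x y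
    refine ciSup_le fun q => ?_
    have h1 := hgp x ((q.2 : 𝕜) • y + q.1, q.2)
    have h2 := hgp y q
    have h3 := hdt ((q.2 : 𝕜) • (x + y) + q.1) ((q.2 : 𝕜) • y + q.1) q.1
    have h4 : (q.2 : 𝕜) • (x + y) + q.1 = (q.2 : 𝕜) • x + ((q.2 : 𝕜) • y + q.1) := by
      rw [smul_add, add_assoc]
    have h5 := hdn ((q.2 : 𝕜) • x + ((q.2 : 𝕜) • y + q.1)) ((q.2 : 𝕜) • y + q.1)
    have h6 := hdn ((q.2 : 𝕜) • y + q.1) q.1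
    refine le_trans ?_ (add_le_add h1 h2)
    simp only [g]
    rw [h4] at h3 ⊢
    rcases min_cases (1 : ℝ) (d ((q.2 : 𝕜) • x + ((q.2 : 𝕜) • y + q.1)) ((q.2 : 𝕜) • y + q.1))
      with h | h <;>
    rcases min_cases (1 : ℝ) (d ((q.2 : 𝕜) • y + q.1) q.1) with h' | h' <;>
    rcases min_cases (1 : ℝ) (d ((q.2 : 𝕜) • x + ((q.2 : 𝕜) • y + q.1)) q.1) with h'' | h'' <;>
    linarith
  · intro t x ht
    refine ciSup_le fun q => ?_
    have hq : ‖(q.2 : 𝕜)‖ ≤ 1 := mem_closedBall_zero_iff.1 q.2.2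
    refine le_of_eq_of_le ?_ (hgp x (q.1, ⟨q.2 * t, by
      simpa using mul_le_one₀ hq (norm_nonneg _) ht⟩))
    simp [g, mul_smul]
  · refine ⟨fun V => ⟨fun hV => ?_, fun ⟨ε, hε, hεV⟩ => mem_of_superset ?_ hεV⟩⟩
    · have hU : (fun q : X × X => q.2 - q.1) ⁻¹' V ∈ uniformity X := by
        rw [uniformity_eq_comap_nhds_zero]
        exact preimage_mem_comap hV
      obtain ⟨ε, hε, h⟩ := hdb _ hU
      refine ⟨min 1 ε, lt_min one_pos hε, fun x hx => ?_⟩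
      have hx1 := (hgp x (0, ⟨-1, by simp⟩)).trans_lt hx
      have hx2 : d (-x) 0 < ε := by
        simp only [g, neg_smul, one_smul, add_zero] at hx1
        rcases min_cases (1 : ℝ) (d (-x) 0) with h' | h' <;>
        rcases min_cases (1 : ℝ) ε with h'' | h'' <;> linarith
      simpa using h _ _ hx2
    · have hU := hdu (ε / 2) (half_pos hε)
      rw [uniformity_eq_comap_nhds_zero, mem_comap] at hU
      obtain ⟨U, hU, hUd⟩ := hU
      filter_upwards [balancedCore_mem_nhds_zero (𝕜 := 𝕜) hU] with x hx
      refine lt_of_le_of_lt (ciSup_le fun q => ?_) (half_lt_self hε)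
      have hq : ‖-(q.2 : 𝕜)‖ ≤ 1 := by
        rw [norm_neg]
        exact mem_closedBall_zero_iff.1 q.2.2
      have hx' : -(q.2 : 𝕜) • x ∈ U :=
        balancedCore_subset U ((balancedCore_balanced U).smul_mem hq hx)
      have : d ((q.2 : 𝕜) • x + q.1) q.1 < ε / 2 :=
        @hUd ((q.2 : 𝕜) • x + q.1, q.1) (by simpa using hx')
      exact (min_le_right _ _).trans this.le

end IsFSeminorm

/-! ### Lower semicontinuous regularization -/

/-- The filter `𝒩` has the properties of the neighbourhood filter of zero in a Hausdorff vector
topology that the argument uses (absorption is omitted). -/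
structure IsZeroNhds (𝕜 : Type*) {X : Type*} [RCLike 𝕜] [AddCommGroup X] [Module 𝕜 X]
    (𝒩 : Filter X) : Prop where
  zero_mem : ∀ N ∈ 𝒩, (0 : X) ∈ N
  add : ∀ N ∈ 𝒩, ∃ M ∈ 𝒩, ∀ x ∈ M, ∀ y ∈ M, x + y ∈ N
  smul : ∀ N ∈ 𝒩, ∀ᶠ x in 𝒩, ∀ t : 𝕜, ‖t‖ ≤ 1 → t • x ∈ N
  sep : ∀ x, (∀ N ∈ 𝒩, x ∈ N) → x = 0

lemma IsHausdorffVectorTopology.isZeroNhds {𝕜 X : Type*} [RCLike 𝕜] [AddCommGroup X] [Module 𝕜 X]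
    {t : TopologicalSpace X} (ht : IsHausdorffVectorTopology 𝕜 X t) :
    IsZeroNhds 𝕜 (@nhds X t 0) := by
  have := ht.isTopologicalAddGroup
  have := ht.continuousSMul
  have := ht.t2Space
  refine ⟨fun N hN => mem_of_mem_nhds hN, fun N hN => ?_, fun N hN => ?_, fun x hx => ?_⟩
  · obtain ⟨V, hV, h⟩ := exists_nhds_zero_half hN
    exact ⟨V, hV, h⟩
  · filter_upwards [balancedCore_mem_nhds_zero (𝕜 := 𝕜) hN] with x hx t ht
    exact balancedCore_subset N ((balancedCore_balanced N).smul_mem ht hx)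
  · by_contra h
    exact hx {x}ᶜ (isOpen_compl_singleton.mem_nhds (Ne.symm h)) rfl

/-- The lower semicontinuous regularization `x ↦ liminf_{n → 0} p (x + n)` of `p`, where `n → 0`
along the filter `𝒩`. -/
noncomputable def lscRegularization {X : Type*} [AddCommGroup X] (p : X → ℝ) (𝒩 : Filter X)
    (x : X) : ℝ :=
  sInf {s | ∃ᶠ n in 𝒩, p (x + n) < s}

section Regularization

variable {𝕜 X : Type*} [RCLike 𝕜] [AddCommGroup X] [Module 𝕜 X] {p : X → ℝ} {𝒩 : Filter X}

lemma IsZeroNhds.frequently (h𝒩 : IsZeroNhds 𝕜 𝒩) {P : X → Prop} (h : P 0) : ∃ᶠ n in 𝒩, P n :=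
  frequently_iff.2 fun hU => ⟨0, h𝒩.zero_mem _ hU, h⟩

lemma bddBelow_lscRegularization (hp : IsFSeminorm 𝕜 p) (x : X) :
    BddBelow {s | ∃ᶠ n in 𝒩, p (x + n) < s} :=
  ⟨0, fun _ hs => let ⟨_, hn⟩ := hs.exists; (hp.nonneg _).trans hn.le⟩

lemma lscRegularization_le_of_frequently (hp : IsFSeminorm 𝕜 p) {x : X} {s : ℝ}
    (h : ∃ᶠ n in 𝒩, p (x + n) < s) : lscRegularization p 𝒩 x ≤ s :=
  csInf_le (bddBelow_lscRegularization hp x) h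

lemma frequently_of_lscRegularization_lt (h𝒩 : IsZeroNhds 𝕜 𝒩) {x : X} {s : ℝ}
    (h : lscRegularization p 𝒩 x < s) : ∃ᶠ n in 𝒩, p (x + n) < s := by
  obtain ⟨s', hs', hlt⟩ := exists_lt_of_csInf_lt
    ⟨p x + 1, h𝒩.frequently (by simp)⟩ h
  exact Frequently.mono hs' fun n hn => hn.trans hlt

lemma lscRegularization_le (hp : IsFSeminorm 𝕜 p) (h𝒩 : IsZeroNhds 𝕜 𝒩) (x : X) :
    lscRegularization p 𝒩 x ≤ p x :=
  le_of_forall_gt_imp_ge_of_dense fun s hs =>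
    lscRegularization_le_of_frequently hp (h𝒩.frequently (by simpa using hs))

lemma isFSeminorm_lscRegularization (hp : IsFSeminorm 𝕜 p) (h𝒩 : IsZeroNhds 𝕜 𝒩) :
    IsFSeminorm 𝕜 (lscRegularization p 𝒩) where
  nonneg x := by
    refine le_csInf ⟨p x + 1, h𝒩.frequently (by simp)⟩ fun s hs => ?_
    obtain ⟨n, hn⟩ := hs.exists
    exact (hp.nonneg _).trans hn.le
  zero := by
    refine le_antisymm ((lscRegularization_le hp h𝒩 0).trans_eq hp.zero) ?_
    refine le_csInf ⟨p 0 + 1, h𝒩.frequently (by simp)⟩ fun s hs => ?_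
    obtain ⟨n, hn⟩ := hs.exists
    exact (hp.nonneg _).trans hn.le
  add_le x y := by
    refine le_of_forall_pos_lt_add fun ε hε => lt_of_le_of_lt
      (lscRegularization_le_of_frequently hp (s := (lscRegularization p 𝒩 x + ε / 3) +
        (lscRegularization p 𝒩 y + ε / 3)) (frequently_iff.2 fun {N} hN => ?_)) (by linarith)
    obtain ⟨M, hM, hMN⟩ := h𝒩.add N hN
    obtain ⟨a, ha, hxa⟩ := frequently_iff.1
      (frequently_of_lscRegularization_lt h𝒩 (lt_add_of_pos_right (lscRegularization p 𝒩 x)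
        (show 0 < ε / 3 by positivity))) hM
    obtain ⟨b, hb, hyb⟩ := frequently_iff.1
      (frequently_of_lscRegularization_lt h𝒩 (lt_add_of_pos_right (lscRegularization p 𝒩 y)
        (show 0 < ε / 3 by positivity))) hM
    refine ⟨a + b, hMN a ha b hb, ?_⟩
    have := hp.add_le (x + a) (y + b)
    rw [add_add_add_comm]
    linarith
  smul_le t x ht := by
    refine le_of_forall_gt_imp_ge_of_dense fun s hs =>
      lscRegularization_le_of_frequently hp (frequently_iff.2 fun {N} hN => ?_)
    obtain ⟨n, hxn, hn⟩ := ((frequently_of_lscRegularization_lt h𝒩 hs).and_eventually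
      (h𝒩.smul N hN)).exists
    refine ⟨t • n, hn t ht, ?_⟩
    rw [← smul_add]
    exact (hp.smul_le t _ ht).trans_lt hxn

lemma lscRegularization_lsc (hp : IsFSeminorm 𝕜 p) (h𝒩 : IsZeroNhds 𝕜 𝒩) (x : X) {ε : ℝ}
    (hε : 0 < ε) :
    ∀ᶠ n in 𝒩, lscRegularization p 𝒩 x - ε < lscRegularization p 𝒩 (x + n) := by
  have h1 : ∀ᶠ n in 𝒩, lscRegularization p 𝒩 x - ε / 2 ≤ p (x + n) := by
    by_contra h
    have h2 := lscRegularization_le_of_frequently hp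
      ((not_eventually.1 h).mono fun n hn => not_le.1 hn)
    linarith
  obtain ⟨M, hM, hMN⟩ := h𝒩.add _ h1
  filter_upwards [hM] with m hm
  refine lt_of_lt_of_le (b := lscRegularization p 𝒩 x - ε / 2) (by linarith) ?_
  by_contra! h
  obtain ⟨n, hn, hlt⟩ := frequently_iff.1 (frequently_of_lscRegularization_lt h𝒩 h) hM
  rw [add_assoc] at hlt
  exact (not_le.2 hlt) (hMN m hm n hn)

lemma eq_zero_of_lscRegularization_eq_zero [TopologicalSpace X]
    (hb : (𝓝 (0 : X)).HasBasis (fun ε : ℝ => 0 < ε) fun ε => {x | p x < ε})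
    (h𝒩 : IsZeroNhds 𝕜 𝒩) (hle : 𝓝 0 ≤ 𝒩) {x : X} (hx : lscRegularization p 𝒩 x = 0) :
    x = 0 := by
  refine h𝒩.sep x fun N hN => ?_
  obtain ⟨M, hM, hMN⟩ := h𝒩.add N hN
  obtain ⟨ε, hε, hεM⟩ := hb.mem_iff.1 (hle hM)
  obtain ⟨n, hn, hnM⟩ := ((frequently_of_lscRegularization_lt (s := ε) h𝒩
    (by rwa [hx])).and_eventually (h𝒩.smul M hM)).exists
  simpa using hMN _ (hεM hn) _ (hnM (-1) (by simp))

/-- The successive approximation argument of the open mapping theorem: if the regularization is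
continuous at zero for the weak topology, then the weak topology is not strictly weaker. -/
lemma le_nhds_of_tendsto_lscRegularization [UniformSpace X] [IsUniformAddGroup X]
    [CompleteSpace X] (hp : IsFSeminorm 𝕜 p)
    (hb : (𝓝 (0 : X)).HasBasis (fun ε : ℝ => 0 < ε) fun ε => {x | p x < ε})
    (h𝒩 : IsZeroNhds 𝕜 𝒩) (hle : 𝓝 0 ≤ 𝒩)
    (h : ∀ r > 0, ∀ᶠ n in 𝒩, lscRegularization p 𝒩 n < r) : 𝒩 ≤ 𝓝 0 := by
  set p' := lscRegularization p 𝒩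
  have hp' : IsFSeminorm 𝕜 p' := isFSeminorm_lscRegularization hp h𝒩
  suffices key : ∀ r > 0, ∀ x, p' x < r → p x ≤ 2 * r by
    refine hb.ge_iff.2 fun ε hε => ?_
    filter_upwards [h (ε / 3) (by positivity)] with x hx
    have := key _ (by positivity) x hx
    show p x < ε
    linarith
  intro r hr x hx
  have step (k : ℕ) (y : X) (hy : p' y < r * (1 / 2) ^ k) :
      ∃ y', p' y' < r * (1 / 2) ^ (k + 1) ∧ p (y - y') < r * (1 / 2) ^ k := by
    obtain ⟨n, hn, hn'⟩ := ((frequently_of_lscRegularization_lt h𝒩 hy).and_eventually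
      (h (r * (1 / 2) ^ (k + 1)) (by positivity))).exists
    exact ⟨-n, by rwa [hp'.neg], by rwa [sub_neg_eq_add]⟩
  choose! f hf hf' using step
  let y : ℕ → X := fun n => Nat.rec x (fun k y => f k y) n
  have hy (k : ℕ) : p' (y k) < r * (1 / 2) ^ k := by
    induction k with
    | zero => simpa [y] using hx
    | succ k ih => exact hf k _ ih
  have hu (k : ℕ) : p (y k - y (k + 1)) ≤ r * (1 / 2) ^ k := (hf' k _ (hy k)).le
  have hsum (n : ℕ) : ∑ i ∈ Finset.range n, (y i - y (i + 1)) = x - y n :=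
    Finset.sum_range_sub' y n
  obtain ⟨s, hs⟩ := hp.exists_tendsto_sum hb (n₀ := 0) hr.le (fun k _ => hu k)
  simp only [hsum] at hs
  have hpow : Tendsto (fun n : ℕ => r * (1 / 2 : ℝ) ^ n) atTop (𝓝 0) := by
    simpa using (tendsto_pow_atTop_nhds_zero_of_lt_one (r := (1 / 2 : ℝ)) (by norm_num)
      (by norm_num)).const_mul r
  have hxs : x - s = 0 := by
    refine eq_zero_of_lscRegularization_eq_zero hb h𝒩 hle (le_antisymm ?_ (hp'.nonneg _))
    refine ge_of_tendsto (x := atTop) (f := fun n => r * (1 / 2 : ℝ) ^ n + p (x - y n - s))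
      (by simpa using hpow.add ((hp.tendsto_iff hb).1 hs)) (Eventually.of_forall fun n => ?_)
    have h1 := hp'.add_le (y n) (x - y n - s)
    have h2 : y n + (x - y n - s) = x - s := by abel
    rw [h2] at h1
    exact h1.trans (add_le_add (hy n).le (lscRegularization_le hp h𝒩 _))
  rw [← sub_zero x, sub_eq_zero.1 hxs]
  refine hp.limit_le hb hs (Eventually.of_forall fun n => ?_)
  have := hp.sum_sub_sum_le' hr.le (n₀ := 0) (fun k _ => hu k) le_rfl (Nat.zero_le n)
  simpa [hsum] using this

end Regularization

/-! ### Equicontinuous sequences of coefficient functionals -/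

/-- Dependent choice for a relation between a term of a sequence and the preceding ones. -/
lemma exists_seq_forall_prefix {α : Type*} [Nonempty α] (Q : ℕ → (ℕ → α) → α → Prop)
    (hQ : ∀ n f g a, (∀ i < n, f i = g i) → Q n f a → Q n g a) (h : ∀ n f, ∃ a, Q n f a) :
    ∃ f : ℕ → α, ∀ n, Q n f (f n) := by
  choose c hc using h
  let g : ℕ → ℕ → α := fun n => Nat.rec (fun _ => Classical.arbitrary α)
    (fun k f => Function.update f k (c k f)) n
  have hg (n : ℕ) : g (n + 1) = Function.update (g n) n (c n (g n)) := rfl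
  have hgi (n i : ℕ) (hi : i < n) : g n i = c i (g i) := by
    induction n with
    | zero => omega
    | succ n ih =>
      rcases Nat.lt_succ_iff_lt_or_eq.1 hi with h | rfl
      · rw [hg, Function.update_of_ne h.ne, ih h]
      · simp [hg]
  exact ⟨fun n => c n (g n), fun n => hQ n (g n) _ _ (hgi n) (hc n (g n))⟩

section BasicSequence

variable {𝕜 X : Type*} [RCLike 𝕜] [AddCommGroup X] [Module 𝕜 X] {p : X → ℝ} {𝒩 : Filter X}

/-- On bounded sets of linear combinations of finitely many vectors, lower semicontinuity of `p`
along `𝒩` is uniform. -/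
lemma eventually_sum_sub_le (hp : IsFSeminorm 𝕜 p)
    (hc : ∀ x, Tendsto (fun t : 𝕜 => p (t • x)) (𝓝 0) (𝓝 0))
    (hlsc : ∀ x, ∀ ε > 0, ∀ᶠ v in 𝒩, p x - ε < p (x + v))
    (x : ℕ → X) (n : ℕ) (R : ℝ) {ε : ℝ} (hε : 0 < ε) :
    ∀ᶠ v in 𝒩, ∀ a : ℕ → 𝕜, (∀ i < n, ‖a i‖ ≤ R) →
      p (∑ i ∈ Finset.range n, a i • x i) ≤ p (∑ i ∈ Finset.range n, a i • x i + v) + ε := by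
  obtain ⟨s, hs, hsa⟩ := hp.exists_finite_net hc x R n (ε / 3) (by positivity)
  filter_upwards [(eventually_all_finite hs).2 fun y _ => hlsc y (ε / 3) (by positivity)]
    with v hv a ha
  obtain ⟨y, hy, hay⟩ := hsa a ha
  set w := ∑ i ∈ Finset.range n, a i • x i
  have h1 := hv y hy
  have h2 := hp.le_sub_add w y
  have h3 := hp.le_sub_add (y + v) (w + v)
  rw [add_sub_add_right_eq_sub, hp.sub_rev] at h3
  linarith

/-- The inductive step in the choice of the sequence: a vector that is small along `𝒩` but not
small for `p` can be adjoined so that the coefficients remain bounded and the truncation increases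
`p` by at most `ε`. -/
lemma exists_adjoin (hp : IsFSeminorm 𝕜 p)
    (hc : ∀ x, Tendsto (fun t : 𝕜 => p (t • x)) (𝓝 0) (𝓝 0))
    (hlsc : ∀ x, ∀ ε > 0, ∀ᶠ v in 𝒩, p x - ε < p (x + v))
    (hsmul : ∀ N ∈ 𝒩, ∀ᶠ x in 𝒩, ∀ t : 𝕜, ‖t‖ ≤ 1 → t • x ∈ N)
    {r : ℝ} (hr : ∃ᶠ v in 𝒩, r ≤ p v)
    (x : ℕ → X) (n : ℕ) {s ε R : ℝ} (hε : 0 < ε) (hεs : 2 * s < r)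
    (hx : ∀ a : ℕ → 𝕜, p (∑ i ∈ Finset.range n, a i • x i) ≤ s → ∀ i < n, ‖a i‖ ≤ R) :
    ∃ v, ∀ (a : ℕ → 𝕜) (t : 𝕜), p (∑ i ∈ Finset.range n, a i • x i + t • v) ≤ s - ε →
      ‖t‖ ≤ 1 ∧ (∀ i < n, ‖a i‖ ≤ |R| + 1) ∧ p (∑ i ∈ Finset.range n, a i • x i) ≤
        p (∑ i ∈ Finset.range n, a i • x i + t • v) + ε := by
  obtain ⟨v, hrv, hv⟩ := (hr.and_eventually (hsmul _
    (eventually_sum_sub_le hp hc hlsc x n (|R| + 1) hε))).exists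
  refine ⟨v, ?_⟩
  have hsmul_sum (c : 𝕜) (a : ℕ → 𝕜) : ∑ i ∈ Finset.range n, (c * a i) • x i =
      c • ∑ i ∈ Finset.range n, a i • x i := by simp [Finset.smul_sum, mul_smul]
  have hR := le_abs_self R
  have hR0 := abs_nonneg R
  -- A combination with too large coefficients is scaled down to one with a coefficient of norm
  -- exactly `|R| + 1`, which `hx` excludes.
  have core (a : ℕ → 𝕜) (t : 𝕜) (ht : ‖t‖ ≤ 1)
      (h : p (∑ i ∈ Finset.range n, a i • x i + t • v) ≤ s - ε) : ∀ i < n, ‖a i‖ ≤ |R| + 1 := by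
    by_contra! hcon
    obtain ⟨i, hi, hRi⟩ := hcon
    obtain ⟨j, hj, hmax⟩ := (Finset.range n).exists_max_image (fun i => ‖a i‖)
      ⟨i, Finset.mem_range.2 hi⟩
    have hRj : |R| + 1 < ‖a j‖ := hRi.trans_le (hmax i (Finset.mem_range.2 hi))
    have hj0 : 0 < ‖a j‖ := by linarith
    let c : 𝕜 := (((|R| + 1) / ‖a j‖ : ℝ) : 𝕜)
    have hcn : ‖c‖ = (|R| + 1) / ‖a j‖ := by
      rw [RCLike.norm_ofReal, abs_of_nonneg (by positivity)]
    have hc1 : ‖c‖ ≤ 1 := by rw [hcn, div_le_one hj0]; exact hRj.le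
    have hcj : ‖c * a j‖ = |R| + 1 := by rw [norm_mul, hcn, div_mul_cancel₀ _ hj0.ne']
    have h1 := hv (c * t) (by rw [norm_mul]; exact mul_le_one₀ hc1 (norm_nonneg _) ht)
      (fun i => c * a i) fun i hi => by
        rw [← hcj, norm_mul, norm_mul]
        exact mul_le_mul_of_nonneg_left (hmax i (Finset.mem_range.2 hi)) (norm_nonneg _)
    have h2 := hp.smul_le c (∑ i ∈ Finset.range n, a i • x i + t • v) hc1
    rw [smul_add, smul_smul, ← hsmul_sum] at h2
    have h3 := hx (fun i => c * a i) (by linarith) j (Finset.mem_range.1 hj)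
    rw [hcj] at h3
    linarith
  intro a t h
  -- If `‖t‖ > 1`, dividing by `t` shows that `v` is close to a small combination of the `x i`.
  have ht : ‖t‖ ≤ 1 := by
    by_contra! ht
    have ht0 : t ≠ 0 := norm_pos_iff.1 (by linarith)
    have ht1 : ‖t⁻¹‖ ≤ 1 := by rw [norm_inv]; exact inv_le_one_of_one_le₀ ht.le
    have h1 := hp.smul_le t⁻¹ (∑ i ∈ Finset.range n, a i • x i + t • v) ht1
    rw [smul_add, smul_smul, inv_mul_cancel₀ ht0, one_smul, ← hsmul_sum] at h1
    have h2 := core (fun i => t⁻¹ * a i) 1 (by simp) (by rw [one_smul]; exact h1.trans h)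
    have h3 := hv 1 (by simp) _ h2
    rw [one_smul] at h3
    have h4 := hp.le_sub_add v (∑ i ∈ Finset.range n, (t⁻¹ * a i) • x i + v)
    rw [show v - (∑ i ∈ Finset.range n, (t⁻¹ * a i) • x i + v) =
      -∑ i ∈ Finset.range n, (t⁻¹ * a i) • x i by abel, hp.neg] at h4
    linarith
  exact ⟨ht, core a t ht h, hv t ht a (core a t ht h)⟩

/-- A basic sequence with bounded coefficients: truncating a small linear combination to its first
`n` terms increases `p` by at most `r * 2⁻ⁿ`. -/
lemma exists_basic_sequence (hp : IsFSeminorm 𝕜 p)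
    (hc : ∀ x, Tendsto (fun t : 𝕜 => p (t • x)) (𝓝 0) (𝓝 0))
    (hlsc : ∀ x, ∀ ε > 0, ∀ᶠ v in 𝒩, p x - ε < p (x + v))
    (hsmul : ∀ N ∈ 𝒩, ∀ᶠ x in 𝒩, ∀ t : 𝕜, ‖t‖ ≤ 1 → t • x ∈ N)
    {r : ℝ} (hr0 : 0 < r) (hr : ∃ᶠ v in 𝒩, 5 * r ≤ p v) :
    ∃ z : ℕ → X, ∀ (a : ℕ → 𝕜) (N : ℕ), p (∑ i ∈ Finset.range N, a i • z i) ≤ r →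
      (∀ n < N, ‖a n‖ ≤ 1) ∧ ∀ n ≤ N, p (∑ i ∈ Finset.range n, a i • z i) ≤
        p (∑ i ∈ Finset.range N, a i • z i) + r * (1 / 2) ^ n := by
  -- The levels `s n` decrease from `2 * r` to `r`, and their differences `ε n` are the losses
  -- allowed at each step; the constant `5` guarantees `2 * s n < 5 * r`.
  let s : ℕ → ℝ := fun n => r * (1 + (1 / 2) ^ n)
  let ε : ℕ → ℝ := fun n => r * (1 / 2) ^ (n + 1)
  have hs (n : ℕ) : s n - ε n = s (n + 1) := by simp only [s, ε]; ring
  let Q : ℕ → (ℕ → X) → X → Prop := fun n x v =>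
    (∃ R : ℝ, ∀ a : ℕ → 𝕜, p (∑ i ∈ Finset.range n, a i • x i) ≤ s n → ∀ i < n, ‖a i‖ ≤ R) →
    ∃ R : ℝ, ∀ (a : ℕ → 𝕜) (t : 𝕜), p (∑ i ∈ Finset.range n, a i • x i + t • v) ≤ s (n + 1) →
      ‖t‖ ≤ 1 ∧ (∀ i < n, ‖a i‖ ≤ |R| + 1) ∧ p (∑ i ∈ Finset.range n, a i • x i) ≤
        p (∑ i ∈ Finset.range n, a i • x i + t • v) + ε n
  obtain ⟨z, hz⟩ := exists_seq_forall_prefix Q (fun n f g v hfg h => by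
      have (a : ℕ → 𝕜) : ∑ i ∈ Finset.range n, a i • g i = ∑ i ∈ Finset.range n, a i • f i :=
        Finset.sum_congr rfl fun i hi => by rw [hfg i (Finset.mem_range.1 hi)]
      simpa only [Q, this] using h) (fun n x => by
      by_cases hx : ∃ R : ℝ, ∀ a : ℕ → 𝕜, p (∑ i ∈ Finset.range n, a i • x i) ≤ s n →
        ∀ i < n, ‖a i‖ ≤ R
      · obtain ⟨R, hR⟩ := hx
        have hpow : (1 / 2 : ℝ) ^ n ≤ 1 := pow_le_one₀ (by norm_num) (by norm_num)
        obtain ⟨v, hv⟩ := exists_adjoin hp hc hlsc hsmul hr x n (ε := ε n) (by positivity)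
          (by simp only [s]; nlinarith) hR
        rw [hs] at hv
        exact ⟨v, fun _ => ⟨R, hv⟩⟩
      · exact ⟨0, fun h => absurd h hx⟩)
  have hbdd (n : ℕ) : ∃ R : ℝ, ∀ a : ℕ → 𝕜, p (∑ i ∈ Finset.range n, a i • z i) ≤ s n →
      ∀ i < n, ‖a i‖ ≤ R := by
    induction n with
    | zero => exact ⟨0, by simp⟩
    | succ n ih =>
      obtain ⟨R, hR⟩ := hz n ih
      refine ⟨|R| + 1, fun a ha i hi => ?_⟩
      rw [Finset.sum_range_succ] at ha
      obtain ⟨h1, h2, -⟩ := hR a _ ha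
      rcases Nat.lt_succ_iff_lt_or_eq.1 hi with h | rfl
      · exact h2 i h
      · linarith [abs_nonneg R]
  refine ⟨z, fun a N hN => ?_⟩
  have hstep (n : ℕ) (h : p (∑ i ∈ Finset.range (n + 1), a i • z i) ≤ s (n + 1)) :
      ‖a n‖ ≤ 1 ∧ p (∑ i ∈ Finset.range n, a i • z i) ≤
        p (∑ i ∈ Finset.range (n + 1), a i • z i) + ε n := by
    obtain ⟨R, hR⟩ := hz n (hbdd n)
    rw [Finset.sum_range_succ] at h ⊢
    exact ⟨(hR a _ h).1, (hR a _ h).2.2⟩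
  have hle (n : ℕ) (hn : n ≤ N) : p (∑ i ∈ Finset.range n, a i • z i) ≤
      p (∑ i ∈ Finset.range N, a i • z i) + r * ((1 / 2) ^ n - (1 / 2) ^ N) := by
    induction hn using Nat.decreasingInduction with
    | self => simp
    | of_succ n hn ih =>
      have hpow : 0 ≤ r * (1 / 2) ^ N := by positivity
      have := (hstep n (ih.trans (by simp only [s]; linarith))).2
      simp only [ε] at this
      rw [pow_succ] at this ih
      linarith
  have hle' (n : ℕ) (hn : n ≤ N) : p (∑ i ∈ Finset.range n, a i • z i) ≤
      p (∑ i ∈ Finset.range N, a i • z i) + r * (1 / 2) ^ n := by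
    have hpow : 0 ≤ r * (1 / 2) ^ N := by positivity
    linarith [hle n hn]
  refine ⟨fun n hn => (hstep n ?_).1, hle'⟩
  have := hle' (n + 1) hn
  simp only [s]
  linarith

end BasicSequence

lemma Finsupp.eventually_linearCombination_eq {𝕜 X : Type*} [RCLike 𝕜] [AddCommGroup X]
    [Module 𝕜 X] (v : ℕ → X) (a : ℕ →₀ 𝕜) : ∀ᶠ N in atTop,
      Finsupp.linearCombination 𝕜 v a = ∑ i ∈ Finset.range N, a i • v i := by
  obtain ⟨N₀, hN₀⟩ := a.support.exists_nat_subset_range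
  filter_upwards [eventually_ge_atTop N₀] with N hN
  rw [Finsupp.linearCombination_apply]
  exact Finsupp.sum_of_support_subset _ (hN₀.trans (Finset.range_mono hN)) _ (by simp)

lemma exists_isZeroNhds_of_not_isMinimalTVS {𝕜 X : Type*} [RCLike 𝕜] [AddCommGroup X]
    [Module 𝕜 X] [t : TopologicalSpace X] [IsTopologicalAddGroup X] (hX : ¬ IsMinimalTVS 𝕜 X) :
    ∃ 𝒩 : Filter X, IsZeroNhds 𝕜 𝒩 ∧ 𝓝 0 ≤ 𝒩 ∧ ¬ 𝒩 ≤ 𝓝 0 := by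
  simp only [IsMinimalTVS, not_forall] at hX
  obtain ⟨t', ht', hle, hne⟩ := hX
  have hle' : @nhds X t 0 ≤ @nhds X t' 0 := (le_iff_nhds t t').1 hle 0
  exact ⟨@nhds X t' 0, ht'.isZeroNhds, hle', fun h => hne (@IsTopologicalAddGroup.ext X _ t' t
    ht'.isTopologicalAddGroup ‹_› (le_antisymm h hle'))⟩

/-- A non-minimal F-space contains a sequence whose coefficient functionals are equicontinuous on
its linear span and remain jointly injective on the closed linear span. -/
theorem exists_total_equicontinuous_sequence {𝕜 X : Type*} [RCLike 𝕜] [AddCommGroup X]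
    [Module 𝕜 X] [UniformSpace X] [IsUniformAddGroup X] [ContinuousSMul 𝕜 X] [CompleteSpace X]
    [TopologicalSpace.MetrizableSpace X] (hX : ¬ IsMinimalTVS 𝕜 X) :
    ∃ z : ℕ → X,
      (∃ U ∈ 𝓝 (0 : X), ∀ a : ℕ →₀ 𝕜, Finsupp.linearCombination 𝕜 z a ∈ U → ∀ i, ‖a i‖ ≤ 1) ∧
      ∀ (a : ℕ → ℕ →₀ 𝕜) (x : X),
        Tendsto (fun m => Finsupp.linearCombination 𝕜 z (a m)) atTop (𝓝 x) →
        (∀ i, Tendsto (fun m => a m i) atTop (𝓝 0)) → x = 0 := by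
  obtain ⟨p₀, hp₀, hb⟩ := IsFSeminorm.exists_hasBasis 𝕜 X
  obtain ⟨𝒩, h𝒩, hle𝒩, hne⟩ := exists_isZeroNhds_of_not_isMinimalTVS hX
  set p := lscRegularization p₀ 𝒩
  have hp : IsFSeminorm 𝕜 p := isFSeminorm_lscRegularization hp₀ h𝒩
  have hpp₀ (x : X) : p x ≤ p₀ x := lscRegularization_le hp₀ h𝒩 x
  have hp0 : Tendsto p (𝓝 0) (𝓝 0) :=
    squeeze_zero hp.nonneg hpp₀ (hp₀.tendsto_zero hb)
  obtain ⟨r, hr, hfreq⟩ : ∃ r > 0, ∃ᶠ v in 𝒩, r ≤ p v := by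
    by_contra! hcon
    refine hne (le_nhds_of_tendsto_lscRegularization hp₀ hb h𝒩 hle𝒩 fun r hr => ?_)
    simpa using hcon r hr
  obtain ⟨z, hz⟩ := exists_basic_sequence hp (fun x => IsFSeminorm.tendsto_smul hp0 x)
    (fun x ε hε => lscRegularization_lsc hp₀ h𝒩 x hε) h𝒩.smul (r := r / 5) (by positivity)
    (by simpa [mul_div_cancel₀] using hfreq)
  set ρ := r / 5
  have hρ : 0 < ρ := by positivity
  set L := Finsupp.linearCombination 𝕜 z
  refine ⟨z, ⟨{x | p x < ρ}, hp0.eventually (gt_mem_nhds hρ), fun a ha i => ?_⟩, ?_⟩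
  · obtain ⟨N, hN, hiN⟩ := ((Finsupp.eventually_linearCombination_eq z a).and
      (eventually_gt_atTop i)).exists
    exact (hz a N (by rw [← hN]; exact le_of_lt ha)).1 i hiN
  intro a x hx ha
  have hpx : Tendsto (fun m => p (L (a m) - x)) atTop (𝓝 0) :=
    hp0.comp (tendsto_sub_nhds_zero_iff.2 hx)
  refine eq_zero_of_lscRegularization_eq_zero hb h𝒩 hle𝒩
    (le_antisymm (le_of_forall_pos_le_add fun ε hε => ?_) (hp.nonneg _))
  obtain ⟨m, hm1, hm2⟩ := ((hpx.eventually (gt_mem_nhds (show 0 < ρ / 2 by positivity))).and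
    (hpx.eventually (gt_mem_nhds (show 0 < ε / 5 by positivity)))).exists
  have hpow : Tendsto (fun n : ℕ => ρ * (1 / 2 : ℝ) ^ n) atTop (𝓝 0) := by
    simpa using (tendsto_pow_atTop_nhds_zero_of_lt_one (r := (1 / 2 : ℝ)) (by norm_num)
      (by norm_num)).const_mul ρ
  obtain ⟨n, hn1, hn2⟩ := ((Finsupp.eventually_linearCombination_eq z (a m)).and
    (hpow.eventually (gt_mem_nhds (show 0 < ε / 5 by positivity)))).exists
  -- Compare `L (a m)`, which is its own truncation, with the truncation of `L (a m - a l)`.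
  -- The truncations of `L (a l)` to the first `n` terms tend to zero as `l → ∞`.
  have hfin : Tendsto (fun l => p (∑ i ∈ Finset.range n, a l i • z i)) atTop (𝓝 0) := by
    refine hp0.comp ?_
    have : Tendsto (fun l => ∑ i ∈ Finset.range n, a l i • z i) atTop
        (𝓝 (∑ i ∈ Finset.range n, (0 : 𝕜) • z i)) :=
      tendsto_finsetSum _ fun i _ => (ha i).smul_const _
    simpa using this
  obtain ⟨l, hl1, hl2, hl3⟩ := ((hpx.eventually (gt_mem_nhds (show 0 < ρ / 2 by positivity))).and
    ((hpx.eventually (gt_mem_nhds (show 0 < ε / 5 by positivity))).and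
      (hfin.eventually (gt_mem_nhds (show 0 < ε / 5 by positivity))))).exists
  obtain ⟨N, hN1, hN2⟩ := ((Finsupp.eventually_linearCombination_eq z (a m - a l)).and
    (eventually_ge_atTop n)).exists
  have hml : p (L (a m - a l)) ≤ p (L (a m) - x) + p (L (a l) - x) := by
    rw [map_sub, hp.sub_rev (L (a l))]
    exact hp.sub_le_add _ _ _
  have key := (hz (a m - a l : ℕ →₀ 𝕜) N (by rw [← hN1]; change p (L (a m - a l)) ≤ ρ; linarith)).2
    n hN2
  rw [← hN1] at key
  change _ ≤ p (L (a m - a l)) + _ at key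
  have h1 : ∑ i ∈ Finset.range n, (a m - a l : ℕ →₀ 𝕜) i • z i =
      L (a m) - ∑ i ∈ Finset.range n, a l i • z i := by
    rw [hn1, ← Finset.sum_sub_distrib]
    exact Finset.sum_congr rfl fun i _ => by rw [Finsupp.sub_apply, sub_smul]
  rw [h1] at key
  have h2 := hp.le_sub_add (L (a m)) (∑ i ∈ Finset.range n, a l i • z i)
  have h3 := hp.le_sub_add x (L (a m))
  rw [hp.sub_rev] at h3
  change p x ≤ 0 + ε
  linarith

/-! ### Series with bounded coefficients -/

section Series

variable {𝕜 E : Type*} [RCLike 𝕜] [AddCommGroup E] [Module 𝕜 E] {p : E → ℝ}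

/-- If the coefficients stay bounded and converge pointwise, then so do the sums of a series whose
terms decay geometrically, uniformly for bounded coefficients. -/
lemma tendsto_linearCombination_of_bounded [UniformSpace E] [IsUniformAddGroup E]
    [ContinuousSMul 𝕜 E] (hp : IsFSeminorm 𝕜 p)
    (hb : (𝓝 (0 : E)).HasBasis (fun ε : ℝ => 0 < ε) fun ε => {x | p x < ε}) {w : ℕ → E}
    (hw : ∀ n : ℕ, ∀ t : 𝕜, ‖t‖ ≤ n → p (t • w n) ≤ (1 / 2) ^ n) {a : ℕ → ℕ →₀ 𝕜} {b : ℕ → 𝕜}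
    {M : ℝ} (ha : ∀ m i, ‖a m i‖ ≤ M) (hab : ∀ i, Tendsto (fun m => a m i) atTop (𝓝 (b i))) {s : E}
    (hs : SeriesConvergesTo (fun i => b i • w i) s) :
    Tendsto (fun m => Finsupp.linearCombination 𝕜 w (a m)) atTop (𝓝 s) := by
  have hbM (i : ℕ) : ‖b i‖ ≤ M := le_of_tendsto (hab i).norm (Eventually.of_forall fun m => ha m i)
  have htail {c : ℕ → 𝕜} (hc : ∀ i, ‖c i‖ ≤ M) {n N : ℕ} (hn : ⌈M⌉₊ ≤ n) (hN : n ≤ N) :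
      p (∑ i ∈ Finset.range N, c i • w i - ∑ i ∈ Finset.range n, c i • w i) ≤ 2 * (1 / 2) ^ n := by
    have := hp.sum_sub_sum_le' (u := fun i => c i • w i) zero_le_one (n₀ := ⌈M⌉₊) (fun i hi => by
      rw [one_mul]
      exact hw i _ ((hc i).trans (Nat.ceil_le.1 hi))) hn hN
    rwa [mul_one] at this
  rw [hp.tendsto_iff hb, Metric.tendsto_nhds]
  intro ε hε
  have hpow : Tendsto (fun n : ℕ => 2 * (1 / 2 : ℝ) ^ n) atTop (𝓝 0) := by
    simpa using (tendsto_pow_atTop_nhds_zero_of_lt_one (r := (1 / 2 : ℝ)) (by norm_num)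
      (by norm_num)).const_mul 2
  obtain ⟨n, hn, hnM⟩ := ((hpow.eventually (gt_mem_nhds (show 0 < ε / 3 by positivity))).and
    (eventually_ge_atTop ⌈M⌉₊)).exists
  have hfin : Tendsto (fun m => ∑ i ∈ Finset.range n, a m i • w i) atTop
      (𝓝 (∑ i ∈ Finset.range n, b i • w i)) :=
    tendsto_finsetSum _ fun i _ => (hab i).smul_const _
  have hlim : p (s - ∑ i ∈ Finset.range n, b i • w i) ≤ 2 * (1 / 2) ^ n :=
    hp.limit_le hb hs (by
      filter_upwards [eventually_ge_atTop n] with N hN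
      exact htail hbM hnM hN)
  filter_upwards [((hp.tendsto_iff hb).1 hfin).eventually (gt_mem_nhds (show 0 < ε / 3 by positivity))]
    with m hm
  obtain ⟨N, hN, hnN⟩ := ((Finsupp.eventually_linearCombination_eq w (a m)).and
    (eventually_ge_atTop n)).exists
  have h1 := htail (ha m) hnM hnN
  rw [← hN] at h1
  have h2 := hp.sub_le_add (Finsupp.linearCombination 𝕜 w (a m))
    (∑ i ∈ Finset.range n, a m i • w i) s
  have h3 := hp.sub_le_add (∑ i ∈ Finset.range n, a m i • w i)
    (∑ i ∈ Finset.range n, b i • w i) s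
  rw [hp.sub_rev s] at hlim
  rw [dist_zero_right, Real.norm_of_nonneg (hp.nonneg _)]
  linarith

lemma exists_seriesConvergesTo_of_bounded [UniformSpace E] [IsUniformAddGroup E] [CompleteSpace E]
    (hp : IsFSeminorm 𝕜 p)
    (hb : (𝓝 (0 : E)).HasBasis (fun ε : ℝ => 0 < ε) fun ε => {x | p x < ε}) {w : ℕ → E}
    (hw : ∀ n : ℕ, ∀ t : 𝕜, ‖t‖ ≤ n → p (t • w n) ≤ (1 / 2) ^ n) {b : ℕ → 𝕜} {M : ℝ}
    (hbM : ∀ i, ‖b i‖ ≤ M) : ∃ s, SeriesConvergesTo (fun i => b i • w i) s :=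
  hp.exists_tendsto_sum hb (n₀ := ⌈M⌉₊) zero_le_one fun i hi => by
    rw [one_mul]
    exact hw i _ ((hbM i).trans (Nat.ceil_le.1 hi))

end Series

/-! ### From sequences to closed subspaces -/

section Spaceable

variable {𝕜 E : Type*} [RCLike 𝕜] [AddCommGroup E] [Module 𝕜 E]

lemma Finsupp.exists_forall_norm_le (a : ℕ →₀ 𝕜) : ∃ i, ∀ j, ‖a j‖ ≤ ‖a i‖ := by
  rcases a.support.eq_empty_or_nonempty with h | h
  · exact ⟨0, fun j => by simp [Finsupp.support_eq_empty.1 h]⟩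
  · obtain ⟨i, -, hi⟩ := a.support.exists_max_image (fun i => ‖a i‖) h
    refine ⟨i, fun j => ?_⟩
    by_cases hj : j ∈ a.support
    · exact hi j hj
    · simp [Finsupp.notMem_support_iff.1 hj]

/-- The diagonal argument: uniformly bounded scalar sequences have a pointwise convergent
subsequence. -/
lemma exists_subseq_pointwise_tendsto (a : ℕ → ℕ → 𝕜) {M : ℝ} (ha : ∀ m i, ‖a m i‖ ≤ M) :
    ∃ (b : ℕ → 𝕜) (φ : ℕ → ℕ), StrictMono φ ∧ (∀ i, ‖b i‖ ≤ M) ∧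
      ∀ i, Tendsto (fun m => a (φ m) i) atTop (𝓝 (b i)) := by
  obtain ⟨b, hb, φ, hφ, h⟩ := (isCompact_univ_pi fun _ : ℕ =>
    isCompact_closedBall (0 : 𝕜) M).tendsto_subseq (x := a) fun m i _ => by simpa using ha m i
  exact ⟨b, φ, hφ, fun i => by simpa using hb i trivial, tendsto_pi_nhds.1 h⟩

/-- The perturbation argument. If `z` lies in `W`, has equicontinuous and total coefficient
functionals, and the nonzero sums of `∑ b n • w n` with bounded `b` avoid `W`, then the closed
linear span of `z n + w n` meets `W` only in zero. -/
lemma eq_zero_of_mem_closure_perturbed_span [UniformSpace E] [IsUniformAddGroup E]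
    [ContinuousSMul 𝕜 E] [CompleteSpace E] [TopologicalSpace.MetrizableSpace E]
    {W F : Submodule 𝕜 E} (hFW : F ≤ W) (hF : IsClosed (F : Set E)) {z : ℕ → F}
    (hz : ∃ U ∈ 𝓝 (0 : F), ∀ a : ℕ →₀ 𝕜, Finsupp.linearCombination 𝕜 z a ∈ U → ∀ i, ‖a i‖ ≤ 1)
    (hz' : ∀ (a : ℕ → ℕ →₀ 𝕜) (x : F),
      Tendsto (fun m => Finsupp.linearCombination 𝕜 z (a m)) atTop (𝓝 x) →
      (∀ i, Tendsto (fun m => a m i) atTop (𝓝 0)) → x = 0)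
    {p : E → ℝ} (hp : IsFSeminorm 𝕜 p)
    (hb : (𝓝 (0 : E)).HasBasis (fun ε : ℝ => 0 < ε) fun ε => {x | p x < ε}) {w : ℕ → E}
    (hw : ∀ n : ℕ, ∀ t : 𝕜, ‖t‖ ≤ n → p (t • w n) ≤ (1 / 2) ^ n)
    (hwW : ∀ (b : ℕ → 𝕜) (M : ℝ) (s : E), (∀ i, ‖b i‖ ≤ M) →
      SeriesConvergesTo (fun i => b i • w i) s → s ∈ W → b = 0)
    {v : E} (hv : v ∈ closure (Set.range (Finsupp.linearCombination 𝕜 fun n => (z n : E) + w n)))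
    (hvW : v ∈ W) : v = 0 := by
  set G := Finsupp.linearCombination 𝕜 fun n => (z n : E) + w n
  have hG (a : ℕ →₀ 𝕜) : G a = (Finsupp.linearCombination 𝕜 z a : F) +
      Finsupp.linearCombination 𝕜 w a := by
    simp [G, Finsupp.linearCombination_apply, Finsupp.sum, smul_add, Finset.sum_add_distrib]
  -- A limit in `W` of combinations with bounded coefficients is zero, by compactness.
  have bounded (a : ℕ → ℕ →₀ 𝕜) (M : ℝ) (ha : ∀ m i, ‖a m i‖ ≤ M) (v : E) (hvW : v ∈ W)
      (hav : Tendsto (fun m => G (a m)) atTop (𝓝 v)) : v = 0 ∧ ∃ φ : ℕ → ℕ, StrictMono φ ∧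
        Tendsto (fun m => Finsupp.linearCombination 𝕜 z (a (φ m))) atTop (𝓝 0) := by
    obtain ⟨b, φ, hφ, hbM, hab⟩ := exists_subseq_pointwise_tendsto (fun m i => a m i) ha
    obtain ⟨s, hs⟩ := exists_seriesConvergesTo_of_bounded hp hb hw hbM
    have hlim := (hav.comp hφ.tendsto_atTop).sub
      (tendsto_linearCombination_of_bounded hp hb hw (fun m => ha (φ m)) hab hs)
    simp only [Function.comp_apply, hG, add_sub_cancel_right] at hlim
    have hvs : v - s ∈ F := hF.mem_of_tendsto hlim (Eventually.of_forall fun m => Subtype.prop _)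
    have hsW : s ∈ W := by simpa using W.sub_mem hvW (hFW hvs)
    obtain rfl := hwW b M s hbM hs hsW
    have hs0 : s = 0 := by
      refine tendsto_nhds_unique hs ?_
      simp
    subst hs0
    have hlimF : Tendsto (fun m => Finsupp.linearCombination 𝕜 z (a (φ m))) atTop
        (𝓝 (⟨v - 0, hvs⟩ : F)) := tendsto_subtype_rng.2 hlim
    have h0 := hz' _ _ hlimF hab
    rw [h0] at hlimF
    exact ⟨by simpa using congrArg Subtype.val h0, φ, hφ, hlimF⟩
  have : (uniformity E).IsCountablyGenerated := by
    rw [uniformity_eq_comap_nhds_zero]; infer_instance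
  obtain ⟨y, hy, hyv⟩ := mem_closure_iff_seq_limit.1 hv
  choose a ha using hy
  obtain rfl : (fun m => G (a m)) = y := funext ha
  by_cases hM : ∃ M : ℝ, ∃ᶠ m in atTop, ∀ i, ‖a m i‖ ≤ M
  · obtain ⟨M, hM⟩ := hM
    obtain ⟨φ, hφ, hφM⟩ := extraction_of_frequently_atTop hM
    exact (bounded (a ∘ φ) M hφM v hvW (hyv.comp hφ.tendsto_atTop)).1
  -- Unbounded coefficients are normalized, and contradict the equicontinuity.
  exfalso
  push Not at hM
  choose k hk using fun m => Finsupp.exists_forall_norm_le (a m)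
  have hq : Tendsto (fun m => ‖a m (k m)‖) atTop atTop := tendsto_atTop.2 fun M =>
    (hM M).mono fun m ⟨i, hi⟩ => hi.le.trans (hk m i)
  let c : ℕ → 𝕜 := fun m => ((‖a m (k m)‖⁻¹ : ℝ) : 𝕜)
  have hcn (m : ℕ) : ‖c m‖ = ‖a m (k m)‖⁻¹ := by simp [c]
  have hc : Tendsto c atTop (𝓝 0) := by
    rw [tendsto_zero_iff_norm_tendsto_zero]
    simp only [hcn]
    exact hq.inv_tendsto_atTop
  obtain ⟨-, φ, hφ, hφ0⟩ := bounded (fun m => c m • a m) 1 (fun m i => by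
    rw [Finsupp.smul_apply, norm_smul, hcn, inv_mul_eq_div]
    exact div_le_one_of_le₀ (hk m i) (norm_nonneg _)) 0 W.zero_mem
    (by simpa using hc.smul hyv)
  obtain ⟨U, hU, hUz⟩ := hz
  have hφ2 := hφ0.const_smul (2 : 𝕜)
  rw [smul_zero] at hφ2
  obtain ⟨m, hm, hm'⟩ := ((hφ2.eventually hU).and
    ((hq.comp hφ.tendsto_atTop).eventually (eventually_gt_atTop 0))).exists
  rw [← map_smul] at hm
  have h1 := hUz _ hm (k (φ m))
  rw [Finsupp.smul_apply, Finsupp.smul_apply, norm_smul, norm_smul, hcn] at h1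
  rw [inv_mul_cancel₀ (show ‖a (φ m) (k (φ m))‖ ≠ 0 from ne_of_gt hm')] at h1
  norm_num at h1

/-- The perturbation argument applied to `w n = ε n • x n`, with nonzero `ε n → 0` so small that the
series `∑ b n • ε n • x n` converge uniformly for bounded `b`. -/
theorem isSpaceable_compl_of_seqIndependent [UniformSpace E] [IsUniformAddGroup E]
    [ContinuousSMul 𝕜 E] [CompleteSpace E] [TopologicalSpace.MetrizableSpace E]
    {W F : Submodule 𝕜 E} (hFW : F ≤ W) (hF : IsClosed (F : Set E)) (hFm : ¬ IsMinimalTVS 𝕜 F)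
    {S : Submodule 𝕜 (ℕ → 𝕜)} (hS : nullSequences 𝕜 ≤ S) {x : ℕ → E} (hx : IsSeqIndependent S x)
    (hxW : IsSeqLineable x S ((W : Set E)ᶜ)) : IsSpaceable 𝕜 ((W : Set E)ᶜ) := by
  have : IsUniformAddGroup F := F.toAddSubgroup.isUniformAddGroup
  have : CompleteSpace F := hF.completeSpace_coe
  have : TopologicalSpace.MetrizableSpace F :=
    Topology.IsEmbedding.subtypeVal.metrizableSpace
  obtain ⟨z, hz, hz'⟩ := exists_total_equicontinuous_sequence hFm
  obtain ⟨p, hp, hb⟩ := IsFSeminorm.exists_hasBasis 𝕜 E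
  have hε (n : ℕ) : ∃ ε : 𝕜, ε ≠ 0 ∧ ‖ε‖ < 1 / ((n : ℝ) + 1) ∧
      ∀ t : 𝕜, ‖t‖ ≤ n → p (t • ε • x n) ≤ (1 / 2) ^ n := by
    have h1 : ∀ᶠ ε : 𝕜 in 𝓝 0, ‖ε‖ < 1 / ((n : ℝ) + 1) := by
      filter_upwards [Metric.ball_mem_nhds (0 : 𝕜) (show 0 < 1 / ((n : ℝ) + 1) by positivity)]
        with ε hε using mem_ball_zero_iff.1 hε
    have h2 := IsFSeminorm.eventually_smul_le (𝕜 := 𝕜) (hp.tendsto_zero hb) (x n) n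
      (show (0 : ℝ) < (1 / 2) ^ n by positivity)
    obtain ⟨ε, h, h0⟩ := (((h1.and h2).filter_mono nhdsWithin_le_nhds).and
      (self_mem_nhdsWithin (a := (0 : 𝕜)) (s := {0}ᶜ))).exists
    exact ⟨ε, h0, h⟩
  choose ε hε0 hε1 hεw using hε
  have hεt : Tendsto ε atTop (𝓝 0) :=
    squeeze_zero_norm (fun n => (hε1 n).le) tendsto_one_div_add_atTop_nhds_zero_nat
  have hwW (b : ℕ → 𝕜) (M : ℝ) (s : E) (hbM : ∀ i, ‖b i‖ ≤ M)
      (hs : SeriesConvergesTo (fun i => b i • ε i • x i) s) (hsW : s ∈ W) : b = 0 := by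
    have hc : (fun i => b i * ε i) ∈ nullSequences 𝕜 := by
      change Tendsto _ _ _
      have h := (hεt.norm).const_mul M
      rw [norm_zero, mul_zero] at h
      refine squeeze_zero_norm (fun i => ?_) h
      rw [norm_mul]
      exact mul_le_mul_of_nonneg_right (hbM i) (norm_nonneg _)
    simp only [smul_smul] at hs
    obtain ⟨s', hs', hconv⟩ := hxW _ (hS hc)
    obtain rfl : s = s' := tendsto_nhds_unique hs hconv
    have hs0 : s = 0 := hs'.resolve_left fun h => h hsW
    have h0 := hx _ (hS hc) (hs0 ▸ hs)
    funext i
    exact (mul_eq_zero.1 (congrFun h0 i)).resolve_right (hε0 i)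
  set G := Finsupp.linearCombination 𝕜 fun n => (z n : E) + ε n • x n with hGdef
  have hGinj : Function.Injective G := by
    refine (injective_iff_map_eq_zero G).2 fun a ha => ?_
    have h1 : Finsupp.linearCombination 𝕜 (fun n => ε n • x n) a =
        -((Finsupp.linearCombination 𝕜 z a : F) : E) := by
      rw [eq_neg_iff_add_eq_zero, ← ha, add_comm]
      simp [G, Finsupp.linearCombination_apply, Finsupp.sum, smul_add, Finset.sum_add_distrib]
    obtain ⟨i, hi⟩ := Finsupp.exists_forall_norm_le a
    refine DFunLike.coe_injective (hwW a _ _ hi ?_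
      (W.neg_mem (hFW (Finsupp.linearCombination 𝕜 z a).2)))
    rw [← h1]
    refine tendsto_const_nhds.congr' ?_
    filter_upwards [Finsupp.eventually_linearCombination_eq (fun n => ε n • x n) a] with N hN
      using hN
  refine ⟨(LinearMap.range G).topologicalClosure, Submodule.isClosed_topologicalClosure _, ?_, ?_⟩
  · intro hfin
    let G' : (ℕ →₀ 𝕜) →ₗ[𝕜] (LinearMap.range G).topologicalClosure := G.codRestrict _ fun a =>
      Submodule.le_topologicalClosure _ (LinearMap.mem_range_self G a)
    have : Module.Finite 𝕜 (ℕ →₀ 𝕜) := Module.Finite.of_injective G'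
      fun a b h => hGinj (congrArg Subtype.val h)
    exact not_finite_iff_infinite.2 inferInstance
      (Module.Finite.finite_basis (Finsupp.basisSingleOne (R := 𝕜) (ι := ℕ)))
  · intro v hv
    by_cases hvW : v ∈ W
    · exact Or.inr (eq_zero_of_mem_closure_perturbed_span hFW hF hz hz' hp hb hεw hwW hv hvW)
    · exact Or.inl hvW

end Spaceable

/-! ### From closed subspaces to sequences -/

section Lineable

variable {𝕜 E : Type*} [RCLike 𝕜] [AddCommGroup E] [Module 𝕜 E]

lemma exists_linearIndependent_nat {V : Submodule 𝕜 E} (hV : ¬ FiniteDimensional 𝕜 V) :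
    ∃ u : ℕ → E, LinearIndependent 𝕜 u ∧ ∀ n, u n ∈ V := by
  let b := Module.Basis.ofVectorSpace 𝕜 V
  have : Infinite (Module.Basis.ofVectorSpaceIndex 𝕜 V) := by
    by_contra h
    rw [not_infinite_iff_finite] at h
    exact hV (Module.Finite.of_basis b)
  let e := Infinite.natEmbedding (Module.Basis.ofVectorSpaceIndex 𝕜 V)
  exact ⟨fun n => b (e n), (b.linearIndependent.comp e e.injective).map' V.subtype V.ker_subtype,
    fun n => (b (e n)).2⟩

/-- Linear combinations of independent vectors with coefficients in a compact set that avoids zero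
are bounded away from zero. -/
lemma exists_pos_le_sum [TopologicalSpace E] [IsTopologicalAddGroup E] [ContinuousSMul 𝕜 E]
    [T2Space E] {p : E → ℝ} (hp : IsFSeminorm 𝕜 p)
    (hb : (𝓝 (0 : E)).HasBasis (fun ε : ℝ => 0 < ε) fun ε => {x | p x < ε}) {x : ℕ → E} (j : ℕ)
    (hx : ∀ c : ℕ → 𝕜, ∑ i ∈ Finset.range j, c i • x i = 0 → ∀ i < j, c i = 0) :
    ∃ δ > 0, ∀ c : ℕ → 𝕜, (∀ i, ‖c i‖ ≤ j) → (∃ i < j, 1 ≤ j * ‖c i‖) →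
      δ ≤ p (∑ i ∈ Finset.range j, c i • x i) := by
  let K : Set (ℕ → 𝕜) := Set.univ.pi (fun _ => Metric.closedBall 0 j) ∩
    ⋃ i ∈ Finset.range j, {c | 1 ≤ j * ‖c i‖}
  have hK : IsCompact K := (isCompact_univ_pi fun _ => isCompact_closedBall _ _).inter_right
    (isClosed_biUnion_finset fun i _ => isClosed_le continuous_const (by fun_prop))
  have hcont : Continuous fun c : ℕ → 𝕜 => p (∑ i ∈ Finset.range j, c i • x i) :=
    (hp.continuous hb).comp (by fun_prop)
  have hmem (c : ℕ → 𝕜) : c ∈ K ↔ (∀ i, ‖c i‖ ≤ j) ∧ ∃ i < j, 1 ≤ j * ‖c i‖ := by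
    simp [K, Set.mem_pi]
  rcases K.eq_empty_or_nonempty with h | h
  · exact ⟨1, one_pos, fun c h1 h2 => absurd ((hmem c).2 ⟨h1, h2⟩) (by simp [h])⟩
  · obtain ⟨c, hc, hmin⟩ := hK.exists_isMinOn h hcont.continuousOn
    refine ⟨_, lt_of_le_of_ne (hp.nonneg _) fun h0 => ?_, fun d h1 h2 => hmin ((hmem d).2 ⟨h1, h2⟩)⟩
    have hzero : ∑ i ∈ Finset.range j, c i • x i = 0 := by
      by_contra hne
      obtain ⟨ε, hε, hεs⟩ := hb.mem_iff.1 (isOpen_compl_singleton.mem_nhds (Ne.symm hne))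
      exact hεs (show p _ < ε by rwa [← h0]) rfl
    obtain ⟨i, hi, hci⟩ := ((hmem c).1 hc).2
    rw [hx c hzero i hi, norm_zero, mul_zero] at hci
    linarith

/-- A linearly independent sequence can be rescaled so that each term is small in comparison with
all earlier partial sums whose coefficients are bounded and not all small. -/
lemma exists_rescaling [TopologicalSpace E] [IsTopologicalAddGroup E] [ContinuousSMul 𝕜 E]
    [T2Space E] {p : E → ℝ} (hp : IsFSeminorm 𝕜 p)
    (hb : (𝓝 (0 : E)).HasBasis (fun ε : ℝ => 0 < ε) fun ε => {x | p x < ε}) {u : ℕ → E}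
    (hu : LinearIndependent 𝕜 u) :
    ∃ ε : ℕ → 𝕜, (∀ n, ε n ≠ 0) ∧
      (∀ n : ℕ, ∀ t : 𝕜, ‖t‖ ≤ n → p (t • ε n • u n) ≤ (1 / 2) ^ n) ∧
      ∀ n : ℕ, ∀ j ≤ n, ∀ c : ℕ → 𝕜, (∀ i, ‖c i‖ ≤ j) → (∃ i < j, 1 ≤ j * ‖c i‖) →
        ∀ t : 𝕜, ‖t‖ ≤ n → p (t • ε n • u n) ≤
          p (∑ i ∈ Finset.range j, c i • ε i • u i) / 4 * (1 / 2) ^ n := by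
  let Q : ℕ → (ℕ → 𝕜) → 𝕜 → Prop := fun n ε e => (∀ i < n, ε i ≠ 0) →
    e ≠ 0 ∧ (∀ t : 𝕜, ‖t‖ ≤ n → p (t • e • u n) ≤ (1 / 2) ^ n) ∧
      ∀ j ≤ n, ∀ c : ℕ → 𝕜, (∀ i, ‖c i‖ ≤ j) → (∃ i < j, 1 ≤ j * ‖c i‖) →
        ∀ t : 𝕜, ‖t‖ ≤ n → p (t • e • u n) ≤
          p (∑ i ∈ Finset.range j, c i • ε i • u i) / 4 * (1 / 2) ^ n
  obtain ⟨ε, hε⟩ := exists_seq_forall_prefix Q (fun n f g e hfg h hg => by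
      obtain ⟨h1, h2, h3⟩ := h fun i hi => by rw [hfg i hi]; exact hg i hi
      refine ⟨h1, h2, fun j hj c hc hc' t ht => ?_⟩
      rw [Finset.sum_congr rfl fun i hi => by
        rw [← hfg i ((Finset.mem_range.1 hi).trans_le hj)]]
      exact h3 j hj c hc hc' t ht) (fun n f => by
      by_cases hf : ∀ i < n, f i ≠ 0
      swap
      · exact ⟨0, fun h => absurd h hf⟩
      have hδ (j : ℕ) (hj : j ∈ Finset.range (n + 1)) :=
        exists_pos_le_sum hp hb (x := fun i => f i • u i) j fun c hc i hi => by
          simp only [smul_smul] at hc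
          exact (mul_eq_zero.1 (linearIndependent_iff'.1 hu _ _ hc i
            (Finset.mem_range.2 hi))).resolve_right (hf i (by rw [Finset.mem_range] at hj; omega))
      choose! δ hδ0 hδ using hδ
      have hp0 := hp.tendsto_zero hb
      have h1 := IsFSeminorm.eventually_smul_le (𝕜 := 𝕜) hp0 (u n) n
        (show (0 : ℝ) < (1 / 2) ^ n by positivity)
      have h2 := (eventually_all_finset (Finset.range (n + 1))).2 fun j hj =>
        IsFSeminorm.eventually_smul_le (𝕜 := 𝕜) hp0 (u n) n
          (C := δ j / 4 * (1 / 2) ^ n) (mul_pos (div_pos (hδ0 j hj) (by norm_num)) (by positivity))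
      obtain ⟨e, ⟨he1, he2⟩, he0⟩ := (((h1.and h2).filter_mono nhdsWithin_le_nhds).and
        (self_mem_nhdsWithin (a := (0 : 𝕜)) (s := {0}ᶜ))).exists
      refine ⟨e, fun _ => ⟨he0, he1, fun j hj c hc hc' t ht => ?_⟩⟩
      have hj' : j ∈ Finset.range (n + 1) := Finset.mem_range.2 (by omega)
      refine (he2 j hj' t ht).trans ?_
      have := hδ j hj' c hc hc'
      gcongr)
  have hne (n : ℕ) : ∀ i < n, ε i ≠ 0 := by
    induction n with
    | zero => simp
    | succ n ih =>
      intro i hi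
      rcases Nat.lt_succ_iff_lt_or_eq.1 hi with h | rfl
      · exact ih i h
      · exact (hε _ ih).1
  exact ⟨ε, fun n => hne _ n n.lt_succ_self, fun n => (hε n (hne n)).2.1,
    fun n => (hε n (hne n)).2.2⟩

/-- Every infinite-dimensional closed subspace of an F-space contains a sequence whose series with
bounded coefficients converge and vanish only if all coefficients do. -/
theorem exists_bounded_independent_sequence [UniformSpace E] [IsUniformAddGroup E]
    [ContinuousSMul 𝕜 E] [CompleteSpace E] [TopologicalSpace.MetrizableSpace E]
    {V : Submodule 𝕜 E} (hVc : IsClosed (V : Set E)) (hV : ¬ FiniteDimensional 𝕜 V) :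
    ∃ x : ℕ → E, ∀ (c : ℕ → 𝕜) (M : ℝ), (∀ i, ‖c i‖ ≤ M) →
      (∃ s ∈ V, SeriesConvergesTo (fun n => c n • x n) s) ∧
      (SeriesConvergesTo (fun n => c n • x n) 0 → c = 0) := by
  obtain ⟨p, hp, hb⟩ := IsFSeminorm.exists_hasBasis 𝕜 E
  obtain ⟨u, hu, huV⟩ := exists_linearIndependent_nat hV
  obtain ⟨ε, hε0, hε1, hε2⟩ := exists_rescaling hp hb hu
  refine ⟨fun n => ε n • u n, fun c M hcM => ⟨?_, fun hc0 => ?_⟩⟩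
  · obtain ⟨s, hs⟩ := exists_seriesConvergesTo_of_bounded hp hb hε1 hcM
    exact ⟨s, hVc.mem_of_tendsto hs (Eventually.of_forall fun N =>
      V.sum_mem fun i _ => V.smul_mem _ (V.smul_mem _ (huV i))), hs⟩
  by_contra hne
  -- Compare a partial sum `P` long enough to see a nonzero coefficient with the tail after it,
  -- which by the rescaling has at most half its size.
  obtain ⟨m, hm⟩ := Function.ne_iff.1 hne
  have hm0 : 0 < ‖c m‖ := norm_pos_iff.2 hm
  obtain ⟨j, hjM, hjm, hmj⟩ : ∃ j : ℕ, M ≤ j ∧ 1 / ‖c m‖ ≤ j ∧ m < j := by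
    obtain ⟨j, hj⟩ := exists_nat_ge (max M (1 / ‖c m‖))
    refine ⟨j + m + 1, ?_, ?_, by omega⟩ <;> push_cast
    · linarith [le_max_left M (1 / ‖c m‖), (Nat.cast_nonneg m : (0 : ℝ) ≤ m)]
    · linarith [le_max_right M (1 / ‖c m‖), (Nat.cast_nonneg m : (0 : ℝ) ≤ m)]
  rw [div_le_iff₀ hm0] at hjm
  have hcj (i : ℕ) : ‖c i‖ ≤ j := (hcM i).trans hjM
  set P := ∑ i ∈ Finset.range j, c i • ε i • u i with hP
  have hC : 0 ≤ p P / 4 := by linarith [hp.nonneg P]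
  have htail (N : ℕ) (hN : j ≤ N) :=
    hp.sum_sub_sum_le' (u := fun i => c i • ε i • u i) hC (n₀ := j) (fun n hn =>
      hε2 n j hn c hcj ⟨m, hmj, hjm⟩ (c n) ((hcj n).trans (by exact_mod_cast hn))) le_rfl hN
  have hlim : p (0 - P) ≤ 2 * (p P / 4) * (1 / 2) ^ j := hp.limit_le hb hc0 (by
    filter_upwards [eventually_ge_atTop j] with N hN using htail N hN)
  rw [zero_sub, hp.neg] at hlim
  have hpow : (1 / 2 : ℝ) ^ j ≤ 1 := pow_le_one₀ (by norm_num) (by norm_num)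
  have hP0 : p P = 0 := le_antisymm (by nlinarith [hp.nonneg P]) (hp.nonneg P)
  obtain ⟨δ, hδ, hδP⟩ := exists_pos_le_sum hp hb (x := fun i => ε i • u i) j fun d hd i hi => by
    simp only [smul_smul] at hd
    exact (mul_eq_zero.1 (linearIndependent_iff'.1 hu _ _ hd i
      (Finset.mem_range.2 hi))).resolve_right (hε0 i)
  have := hδP c hcj ⟨m, hmj, hjm⟩
  rw [← hP, hP0] at this
  linarith

end Lineable

theorem theorem3p6 {𝕜 E : Type*} [RCLike 𝕜] [AddCommGroup E] [Module 𝕜 E]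
    [UniformSpace E] [IsUniformAddGroup E] [ContinuousSMul 𝕜 E]
    [CompleteSpace E] [TopologicalSpace.MetrizableSpace E]
    (W : Submodule 𝕜 E)
    (hW : ∃ F : Submodule 𝕜 E, F ≤ W ∧ IsClosed (F : Set E) ∧ ¬ IsMinimalTVS 𝕜 F) :
    IsSpaceable 𝕜 ((W : Set E)ᶜ) ↔
      ∃ S : Submodule 𝕜 (lp (fun _ : ℕ => 𝕜) ∞),
        IsClosed (S : Set (lp (fun _ : ℕ => 𝕜) ∞)) ∧
        nullSequences 𝕜 ≤ S.map (lInftyToSeq 𝕜) ∧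
        ∃ x : ℕ → E,
          IsSeqIndependent (S.map (lInftyToSeq 𝕜)) x ∧
          IsSeqLineable x (S.map (lInftyToSeq 𝕜)) ((W : Set E)ᶜ) := by
  constructor
  · rintro ⟨V, hVc, hV, hVW⟩
    obtain ⟨x, hx⟩ := exists_bounded_independent_sequence hVc hV
    have hbdd : ∀ c ∈ (⊤ : Submodule 𝕜 (lp (fun _ : ℕ => 𝕜) ∞)).map (lInftyToSeq 𝕜),
        ∃ M : ℝ, ∀ i, ‖c i‖ ≤ M := by
      rintro _ ⟨c, -, rfl⟩
      exact ⟨‖c‖, fun i => lp.norm_apply_le_norm ENNReal.top_ne_zero c i⟩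
    refine ⟨⊤, isClosed_univ, fun c hc => ?_, x, fun c hc => ?_, fun c hc => ?_⟩
    · have hc' : Memℓp c ∞ := memℓp_infty (Tendsto.bddAbove_range (Tendsto.norm hc))
      exact ⟨⟨c, hc'⟩, trivial, rfl⟩
    · obtain ⟨M, hM⟩ := hbdd c hc
      exact (hx c M hM).2
    · obtain ⟨M, hM⟩ := hbdd c hc
      obtain ⟨s, hs, hconv⟩ := (hx c M hM).1
      exact ⟨s, hVW hs, hconv⟩
  · rintro ⟨S, -, hS, x, hx, hxW⟩
    obtain ⟨F, hFW, hF, hFm⟩ := hW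
    exact isSpaceable_compl_of_seqIndependent hFW hF hFm hS hx hxW
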